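/- Let $g,n$ be positive integers and $N=2gn$. For $0\le w\le N$ let $|D^N_w\rangle=\binom{N}{w}^{-1/2}\sum_{x\in\{0,1\}^N,\ x_1+\dots+x_N=w}|x_1\rangle\otimes\cdots\otimes|x_N\rangle$ be the Dicke states on $N$ qubits, and let $$|\varphi_2\rangle=\sqrt{2^{-n}}\sum_{j=0}^{n}\sqrt{\tbinom nj}\,|D^{N}_{gj}\rangle .$$ Let $Z_j$ denote the Pauli operator $Z$ acting on the $j$th qubit, and for $x\in\{0,1\}^N$ let $Z_x=Z^{x_1}\otimes\cdots\otimes Z^{x_N}$. Let $p\in[0,1]$, let $$\sigma=\sum_{j=0}^{N}p^j(1-p)^{N-j}\sum_{x\in\{0,1\}^N,\ x_1+\dots+x_N=j}Z_x|\varphi_2\rangle\langle\varphi_2|Z_x$$ be the state obtained from $|\varphi_2\rangle\langle\varphi_2|$ when every qubit independently suffers a $Z$ error with probability $p$, and let $t=pN$ be the expected number of errors. Put $v_j=\langle\varphi_2|Z_1\cdots Z_j|\varphi_2\rangle$ and $g_2=2(z_{0,2,2}-z_{1,1,2})$, where $$z_{0,2,2}=N(N-1)v_2\big((N-2)(N-3)v_4+(5N-8)v_2+2\big)+N^2+N^2(N-1)v_2,$$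 $$z_{1,1,2}=N(N-1)(N-2)^2v_3^2+N(N-1)+2N(N-1)(N-2)v_3+\tfrac{N^3}{4}$$ (for $N=2$ the terms containing $v_3$ and $v_4$ are read as $0$). For a state $\rho$ with spectral decomposition $\rho=\sum_k\lambda_k|e_k\rangle\langle e_k|$, the quantum Fisher information with respect to the generator $H=\sum_{j=1}^N Z_j$ is $$F(\rho)=2\sum_{k,l:\ \lambda_k+\lambda_l>0}\frac{(\lambda_k-\lambda_l)^2}{\lambda_k+\lambda_l}\,|\langle e_k|H|e_l\rangle|^2 .$$ Then $$F(\sigma)\ \ge\ (1-p)^{2N-2}\left(2(1-p)^2g^2n+p(1-p)g^2(n-1)+p^2\frac{g_2}{N^2}\right)-2N^2t\,e,$$ where $e$ is Euler's number. -/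

import Mathlib

/-! # Gnu probe states, i.i.d. dephasing and the quantum Fisher information

The state space `(ℂ²)^{⊗N}` of `N` qubits is modelled by functions on the set of bit strings
`Fin N → Fin 2` (the computational basis), and operators by matrices indexed by bit strings. -/

namespace Metrology

/-- Bit strings of length `N`, the labels of the computational basis of `N` qubits. -/
abbrev Bits (N : ℕ) : Type := Fin N → Fin 2

/-- The number of 1s in a bit string. -/
def weight {N : ℕ} (x : Bits N) : ℕ := ∑ i, (x i : ℕ)

/-- The single-qubit Pauli operator `Z`. -/
def pauliZ : Matrix (Fin 2) (Fin 2) ℂ := !![1, 0; 0, -1]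

/-- The tensor product `A₁ ⊗ ⋯ ⊗ A_N` of single-qubit operators. -/
def tensorOp {N : ℕ} (A : Fin N → Matrix (Fin 2) (Fin 2) ℂ) : Matrix (Bits N) (Bits N) ℂ :=
  Matrix.of fun y z => ∏ i, A i (y i) (z i)

/-- `Z_x = Z^{x₁} ⊗ ⋯ ⊗ Z^{x_N}`. -/
def zString {N : ℕ} (x : Bits N) : Matrix (Bits N) (Bits N) ℂ :=
  tensorOp fun i => pauliZ ^ (x i : ℕ)

/-- `Z` on qubit `j`, the identity on all other qubits. -/
def zAt {N : ℕ} (j : Fin N) : Matrix (Bits N) (Bits N) ℂ :=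
  tensorOp fun i => if i = j then pauliZ else 1

/-- The generator `H = ∑ⱼ Zⱼ`. -/
def generator (N : ℕ) : Matrix (Bits N) (Bits N) ℂ := ∑ j : Fin N, zAt j

/-- The Dicke state `|D^N_w⟩`. -/
noncomputable def dicke (N w : ℕ) : Bits N → ℂ := fun x =>
  if weight x = w then ((1 / Real.sqrt (N.choose w) : ℝ) : ℂ) else 0

/-- The gnu probe state `√(2^{-n}) ∑_{j=0}^n √(n choose j) |D^N_{gj}⟩` on `N = gnu` qubits;
it depends on the scaling parameter `u` only through `N`. -/
noncomputable def gnuProbe (N g n : ℕ) : Bits N → ℂ := fun x =>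
  ((Real.sqrt (1 / 2 ^ n) : ℝ) : ℂ) *
    ∑ j ∈ Finset.range (n + 1), ((Real.sqrt (n.choose j) : ℝ) : ℂ) * dicke N (g * j) x

/-- The operator `|φ⟩⟨φ|`. -/
def proj {ι : Type*} (φ : ι → ℂ) : Matrix ι ι ℂ := Matrix.vecMulVec φ (star φ)

/-- The state obtained from `|φ⟩⟨φ|` when each qubit independently suffers a `Z` error with
probability `p`:
`∑_{j=0}^N p^j (1-p)^{N-j} ∑_{x of weight j} Z_x |φ⟩⟨φ| Z_x`. -/
noncomputable def dephased {N : ℕ} (p : ℝ) (φ : Bits N → ℂ) : Matrix (Bits N) (Bits N) ℂ :=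
  ∑ j ∈ Finset.range (N + 1), ((p ^ j * (1 - p) ^ (N - j) : ℝ) : ℂ) •
    ∑ x : Bits N with weight x = j, zString x * proj φ * zString x

/-- The quantum Fisher information of the state `ρ` for the unitary family
`χ ↦ exp(-iχH) ρ exp(iχH)`:
`2 ∑_{k,l : λ_k + λ_l > 0} (λ_k - λ_l)² / (λ_k + λ_l) |⟨e_k|H|e_l⟩|²`,
with `λ` the eigenvalues of `ρ` and `e` an orthonormal eigenbasis (the columns of the
eigenvector unitary). The value does not depend on the choice of the eigenbasis. -/
noncomputable def qfi {ι : Type*} [Fintype ι] [DecidableEq ι] (ρ H : Matrix ι ι ℂ)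
    (hρ : ρ.IsHermitian) : ℝ :=
  2 * ∑ k, ∑ l,
    if 0 < hρ.eigenvalues k + hρ.eigenvalues l then
      (hρ.eigenvalues k - hρ.eigenvalues l) ^ 2 / (hρ.eigenvalues k + hρ.eigenvalues l) *
        ‖(star (hρ.eigenvectorUnitary : Matrix ι ι ℂ) * H *
          (hρ.eigenvectorUnitary : Matrix ι ι ℂ)) k l‖ ^ 2
    else 0

/-- `v_j = ⟨φ|Z₁ ⋯ Z_j|φ⟩` (for `j ≤ N`; `Z` acts on the first `j` qubits). The expectation is
real because the operator is Hermitian. -/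
noncomputable def zMoment {N : ℕ} (φ : Bits N → ℂ) (j : ℕ) : ℝ :=
  (star φ ⬝ᵥ (tensorOp fun i : Fin N => if (i : ℕ) < j then pauliZ else 1).mulVec φ).re

/-- `z_{0,2,2}` as a function of `N`, `v₂` and `v₄`. -/
noncomputable def z022 (N v₂ v₄ : ℝ) : ℝ :=
  N * (N - 1) * v₂ * ((N - 2) * (N - 3) * v₄ + (5 * N - 8) * v₂ + 2)
    + N ^ 2 + N ^ 2 * (N - 1) * v₂

/-- `z_{1,1,2}` as a function of `N` and `v₃`. -/
noncomputable def z112 (N v₃ : ℝ) : ℝ :=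
  N * (N - 1) * (N - 2) ^ 2 * v₃ ^ 2 + N * (N - 1)
    + 2 * N * (N - 1) * (N - 2) * v₃ + N ^ 3 / 4

/-- `g₂ = 2 (z_{0,2,2} - z_{1,1,2})`, evaluated at the moments of the state `φ`. For `N = 2` the
moments `v₃` and `v₄`, which need more than two qubits, have coefficient zero. -/
noncomputable def gTwo {N : ℕ} (φ : Bits N → ℂ) : ℝ :=
  2 * (z022 N (zMoment φ 2) (zMoment φ 4) - z112 N (zMoment φ 3))

theorem pauliZ_isHermitian : pauliZ.IsHermitian := by
  ext i j
  fin_cases i <;> fin_cases j <;> simp [pauliZ]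

theorem tensorOp_isHermitian {N : ℕ} {A : Fin N → Matrix (Fin 2) (Fin 2) ℂ}
    (hA : ∀ i, (A i).IsHermitian) : (tensorOp A).IsHermitian := by
  ext y z
  simp only [tensorOp, Matrix.conjTranspose_apply, Matrix.of_apply, star_prod]
  exact Finset.prod_congr rfl fun i _ => (hA i).apply (y i) (z i)

theorem zString_isHermitian {N : ℕ} (x : Bits N) : (zString x).IsHermitian :=
  tensorOp_isHermitian fun _ => pauliZ_isHermitian.pow _

theorem proj_isHermitian {ι : Type*} (φ : ι → ℂ) : (proj φ).IsHermitian := by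
  ext i j
  simp [proj, Matrix.vecMulVec_apply, mul_comm]

/-- The dephased state is Hermitian, so that it has a spectral decomposition. -/
theorem dephased_isHermitian {N : ℕ} (p : ℝ) (φ : Bits N → ℂ) :
    (dephased p φ).IsHermitian := by
  unfold dephased Matrix.IsHermitian
  rw [Matrix.conjTranspose_sum]
  refine Finset.sum_congr rfl fun j _ => ?_
  rw [Matrix.conjTranspose_smul, Matrix.conjTranspose_sum]
  congr 1
  · exact Complex.conj_ofReal _
  · refine Finset.sum_congr rfl fun x _ => ?_
    rw [Matrix.conjTranspose_mul, Matrix.conjTranspose_mul, (zString_isHermitian x).eq,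
      (proj_isHermitian φ).eq, Matrix.mul_assoc]

end Metrology

/-! For a state `ρ`, distinct eigenvalues indices satisfy `λ_k + λ_l ≤ 1`, so dropping the
denominators in the Fisher information leaves twice the squared Frobenius norm of `[ρ, H]` as a
lower bound (`two_mul_sum_norm_sq_commutator_le_qfi`). That norm is basis independent, and in the
computational basis everything is explicit: `H` is diagonal, and dephasing multiplies each coherence
by a product of factors `1` or `1 - 2p` (`dephased_apply`). Hence `F ≥ 8(1-2p)^(2N)` times the sum
of squared weight differences in the probe. The weight is `g` times a symmetric binomial variable,
so with `A = g²n` this reads `F ≥ 4A(1-2p)^(2N)` (`le_qfi_dephased_gnuProbe`).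

The claimed bound lies below this by crude estimates: `gTwo ≤ 2N⁴`, `e ≥ 2`, `A ≤ N²/4` and
Bernoulli's inequality. The subtracted term, at least `4N³p`, absorbs every error of order `p`. -/

namespace Metrology

open Matrix

open scoped ComplexOrder

/-! ### Diagonal form of the operators -/

/-- The eigenvalue of the Pauli operator `Z` at a computational basis state of one qubit. -/
def bitSign (b : Fin 2) : ℝ := (-1) ^ (b : ℕ)

theorem bitSign_mul_self (b : Fin 2) : bitSign b * bitSign b = 1 := by
  fin_cases b <;> simp [bitSign]

theorem abs_bitSign (b : Fin 2) : |bitSign b| = 1 := by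
  simp [bitSign, abs_pow]

theorem bitSign_eq (b : Fin 2) : bitSign b = 1 - 2 * ((b : ℕ) : ℝ) := by
  fin_cases b <;> norm_num [bitSign]

theorem pauliZ_eq_diagonal : pauliZ = diagonal fun b => ((bitSign b : ℝ) : ℂ) := by
  ext i j
  fin_cases i <;> fin_cases j <;> simp [pauliZ, bitSign]

theorem tensorOp_diagonal {N : ℕ} (d : Fin N → Fin 2 → ℂ) :
    tensorOp (fun i => diagonal (d i)) = diagonal fun y : Bits N => ∏ i, d i (y i) := by
  ext y z
  simp only [tensorOp, of_apply]
  by_cases h : y = z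
  · subst h
    simp
  · rw [diagonal_apply_ne _ h]
    obtain ⟨i, hi⟩ := Function.ne_iff.mp h
    exact Finset.prod_eq_zero (Finset.mem_univ i) (diagonal_apply_ne _ hi)

theorem zString_eq_diagonal {N : ℕ} (x : Bits N) :
    zString x = diagonal fun y => ((∏ i, bitSign (y i) ^ (x i : ℕ) : ℝ) : ℂ) := by
  have h : ∀ i, pauliZ ^ (x i : ℕ) =
      diagonal ((fun b => ((bitSign b : ℝ) : ℂ)) ^ (x i : ℕ)) := fun i => by
    rw [pauliZ_eq_diagonal, diagonal_pow]
  unfold zString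
  simp_rw [h]
  rw [tensorOp_diagonal]
  simp

theorem tensorOp_ite_pauliZ {N : ℕ} (P : Fin N → Prop) [DecidablePred P] :
    (tensorOp fun i => if P i then pauliZ else 1) =
      diagonal fun y => ((∏ i, (if P i then bitSign (y i) else 1) : ℝ) : ℂ) := by
  have h : ∀ i, (if P i then pauliZ else 1) =
      diagonal (fun b => (((if P i then bitSign b else 1) : ℝ) : ℂ)) := fun i => by
    split_ifs
    · exact pauliZ_eq_diagonal
    · simp
  simp_rw [h]
  rw [tensorOp_diagonal]
  simp

theorem generator_eq_diagonal (N : ℕ) :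
    generator N = diagonal fun y => (((N : ℝ) - 2 * weight y : ℝ) : ℂ) := by
  unfold generator zAt
  simp_rw [tensorOp_ite_pauliZ]
  ext y z
  rw [Matrix.sum_apply]
  by_cases h : y = z
  · subst h
    simp only [diagonal_apply_eq, Finset.prod_ite_eq', Finset.mem_univ, if_true]
    rw [← Complex.ofReal_sum]
    simp [bitSign_eq, weight, Finset.mul_sum]
  · simp [diagonal_apply_ne _ h]

/-! ### The dephasing channel in the computational basis -/

theorem weight_le {N : ℕ} (x : Bits N) : weight x ≤ N := by
  unfold weight
  calc ∑ i, (x i : ℕ) ≤ ∑ _i : Fin N, 1 := Finset.sum_le_sum fun i _ => by omega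
    _ = N := by simp

theorem pow_weight_mul_pow {N : ℕ} (a b : ℝ) (x : Bits N) :
    a ^ weight x * b ^ (N - weight x) = ∏ i, a ^ (x i : ℕ) * b ^ (1 - (x i : ℕ)) := by
  have h : ∑ i, (1 - (x i : ℕ)) + weight x = N := by
    rw [weight, ← Finset.sum_add_distrib]
    calc ∑ i, (1 - (x i : ℕ) + (x i : ℕ)) = ∑ _i : Fin N, 1 :=
          Finset.sum_congr rfl fun i _ => by omega
      _ = N := by simp
  rw [Finset.prod_mul_distrib, Finset.prod_pow_eq_pow_sum, Finset.prod_pow_eq_pow_sum,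
    ← weight, Nat.sub_eq_of_eq_add h.symm]

theorem dephased_eq_sum {N : ℕ} (p : ℝ) (φ : Bits N → ℂ) :
    dephased p φ = ∑ x : Bits N, ((p ^ weight x * (1 - p) ^ (N - weight x) : ℝ) : ℂ) •
      (zString x * proj φ * zString x) := by
  unfold dephased
  rw [← Finset.sum_fiberwise_of_maps_to (s := Finset.univ) (t := Finset.range (N + 1))
    (g := weight) fun x _ => Finset.mem_range.mpr (Nat.lt_succ_of_le (weight_le x))]
  refine Finset.sum_congr rfl fun j _ => ?_
  rw [Finset.smul_sum]
  refine Finset.sum_congr rfl fun x hx => ?_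
  rw [(Finset.mem_filter.mp hx).2]

/-- Dephasing multiplies each coherence of `|φ⟩⟨φ|` by a factor `1 - 2p` for every qubit on which
the two bit strings differ. -/
theorem dephased_apply {N : ℕ} (p : ℝ) (φ : Bits N → ℂ) (y z : Bits N) :
    dephased p φ y z = φ y * star (φ z) *
      ((∏ i, (1 - p + p * (bitSign (y i) * bitSign (z i))) : ℝ) : ℂ) := by
  have key : (∏ i, (1 - p + p * (bitSign (y i) * bitSign (z i)))) =
      ∑ x : Bits N, p ^ weight x * (1 - p) ^ (N - weight x) *
        ((∏ i, bitSign (y i) ^ (x i : ℕ)) * ∏ i, bitSign (z i) ^ (x i : ℕ)) := by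
    simp_rw [pow_weight_mul_pow, ← Finset.prod_mul_distrib]
    -- Errors on different qubits are independent, so the sum over error strings factorises qubit by
    -- qubit.
    rw [← Fintype.prod_sum fun i (b : Fin 2) => p ^ (b : ℕ) * (1 - p) ^ (1 - (b : ℕ)) *
      (bitSign (y i) ^ (b : ℕ) * bitSign (z i) ^ (b : ℕ))]
    simp
  rw [key, dephased_eq_sum, Matrix.sum_apply, Complex.ofReal_sum, Finset.mul_sum]
  refine Finset.sum_congr rfl fun x _ => ?_
  rw [zString_eq_diagonal, Matrix.smul_apply, mul_diagonal, diagonal_mul, proj, vecMulVec_apply]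
  push_cast
  simp only [smul_eq_mul, Pi.star_apply]
  ring

theorem dephased_posSemidef {N : ℕ} {p : ℝ} (hp0 : 0 ≤ p) (hp1 : p ≤ 1) (φ : Bits N → ℂ) :
    (dephased p φ).PosSemidef := by
  rw [dephased_eq_sum]
  refine posSemidef_sum _ fun x _ => PosSemidef.smul ?_ ?_
  · have h := (posSemidef_vecMulVec_self_star φ).mul_mul_conjTranspose_same (zString x)
    rwa [(zString_isHermitian x).eq] at h
  · have : 0 ≤ 1 - p := by linarith
    exact Complex.zero_le_real.mpr (by positivity)

theorem trace_dephased {N : ℕ} (p : ℝ) (φ : Bits N → ℂ) :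
    (dephased p φ).trace = ((∑ y, ‖φ y‖ ^ 2 : ℝ) : ℂ) := by
  simp only [trace, diag_apply, dephased_apply, bitSign_mul_self]
  push_cast
  refine Finset.sum_congr rfl fun y _ => ?_
  rw [Complex.star_def, Complex.mul_conj']
  simp

/-- A coherence factor of the dephasing channel is at least the one of strings that differ
everywhere. -/
theorem dephasing_factor_sq_ge {N : ℕ} {p : ℝ} (hp0 : 0 ≤ p) (hp1 : p ≤ 1) (y z : Bits N) :
    (1 - 2 * p) ^ (2 * N) ≤ (∏ i, (1 - p + p * (bitSign (y i) * bitSign (z i)))) ^ 2 := by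
  rw [← Finset.prod_pow]
  calc (1 - 2 * p) ^ (2 * N) = ∏ _i : Fin N, (1 - 2 * p) ^ 2 := by simp [pow_mul]
    _ ≤ _ := Finset.prod_le_prod (fun _ _ => sq_nonneg _) fun i _ => by
      have h : bitSign (y i) * bitSign (z i) = 1 ∨ bitSign (y i) * bitSign (z i) = -1 := by
        rw [← abs_eq zero_le_one, abs_mul, abs_bitSign, abs_bitSign, one_mul]
      rcases h with h | h <;> rw [h] <;> nlinarith

/-! ### Fisher information and the Frobenius norm of the commutator -/

section Frobenius

variable {ι : Type*} [Fintype ι]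

theorem sum_norm_sq_eq_trace (M : Matrix ι ι ℂ) :
    ((∑ k, ∑ l, ‖M k l‖ ^ 2 : ℝ) : ℂ) = (M * Mᴴ).trace := by
  simp [trace, mul_apply, Complex.mul_conj']

variable [DecidableEq ι]

theorem sum_norm_sq_unitary_conj (U : unitaryGroup ι ℂ) (M : Matrix ι ι ℂ) :
    ∑ k, ∑ l, ‖(star (U : Matrix ι ι ℂ) * M * (U : Matrix ι ι ℂ)) k l‖ ^ 2 =
      ∑ k, ∑ l, ‖M k l‖ ^ 2 := by
  have hU : (U : Matrix ι ι ℂ) * star (U : Matrix ι ι ℂ) = 1 := mem_unitaryGroup_iff.mp U.2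
  apply Complex.ofReal_injective
  rw [sum_norm_sq_eq_trace, sum_norm_sq_eq_trace, ← star_eq_conjTranspose, ← star_eq_conjTranspose,
    star_mul, star_mul, star_star]
  calc (star (U : Matrix ι ι ℂ) * M * U * (star (U : Matrix ι ι ℂ) * (star M * U))).trace
      = (star (U : Matrix ι ι ℂ) * (M * (U * star (U : Matrix ι ι ℂ)) * star M * U)).trace := by
        simp only [Matrix.mul_assoc]
    _ = (M * star M).trace := by
        rw [trace_mul_comm, hU, Matrix.mul_one, Matrix.mul_assoc, hU, Matrix.mul_one]

/-- For a state `ρ`, the quantum Fisher information is at least twice the squared Frobenius norm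
of the commutator of `ρ` with the generator. -/
theorem two_mul_sum_norm_sq_commutator_le_qfi {ρ H : Matrix ι ι ℂ} (hρ : ρ.IsHermitian)
    (hpos : ρ.PosSemidef) (htr : ρ.trace = 1) :
    2 * ∑ k, ∑ l, ‖(ρ * H - H * ρ) k l‖ ^ 2 ≤ qfi ρ H hρ := by
  set U := hρ.eigenvectorUnitary with hUdef
  have hU : star (U : Matrix ι ι ℂ) * (U : Matrix ι ι ℂ) = 1 := mem_unitaryGroup_iff'.mp U.2
  set D : Matrix ι ι ℂ := diagonal fun k => (hρ.eigenvalues k : ℂ) with hD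
  set K := star (U : Matrix ι ι ℂ) * H * (U : Matrix ι ι ℂ) with hK
  have hspec : ρ = U * D * star (U : Matrix ι ι ℂ) := by
    have := hρ.spectral_theorem
    rwa [Unitary.conjStarAlgAut_apply] at this
  have hconj : star (U : Matrix ι ι ℂ) * (ρ * H - H * ρ) * U = D * K - K * D := by
    rw [hK]
    calc star (U : Matrix ι ι ℂ) * (ρ * H - H * ρ) * U
        = star (U : Matrix ι ι ℂ) * (U * D * star (U : Matrix ι ι ℂ) * H -
            H * (U * D * star (U : Matrix ι ι ℂ))) * U := by rw [← hspec]
      _ = (star (U : Matrix ι ι ℂ) * U) * D * (star (U : Matrix ι ι ℂ) * H * U) -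
          (star (U : Matrix ι ι ℂ) * H * U) * D * (star (U : Matrix ι ι ℂ) * U) := by
        simp only [Matrix.mul_sub, Matrix.sub_mul, Matrix.mul_assoc]
      _ = _ := by rw [hU, Matrix.one_mul, Matrix.mul_one]
  have hnn : ∀ k, 0 ≤ hρ.eigenvalues k := hpos.eigenvalues_nonneg
  have hsum : ∑ k, hρ.eigenvalues k = 1 := by
    have h := hρ.trace_eq_sum_eigenvalues
    rw [htr] at h
    have h' : ((∑ k, hρ.eigenvalues k : ℝ) : ℂ) = ((1 : ℝ) : ℂ) := by
      rw [Complex.ofReal_one, h, Complex.ofReal_sum]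
      rfl
    exact Complex.ofReal_injective h'
  rw [← sum_norm_sq_unitary_conj U, hconj]
  unfold qfi
  rw [← hUdef, ← hK]
  refine mul_le_mul_of_nonneg_left (Finset.sum_le_sum fun k _ => Finset.sum_le_sum fun l _ => ?_)
    zero_le_two
  have hentry : ‖(D * K - K * D) k l‖ ^ 2 =
      (hρ.eigenvalues k - hρ.eigenvalues l) ^ 2 * ‖K k l‖ ^ 2 := by
    have : (D * K - K * D) k l =
        ((hρ.eigenvalues k - hρ.eigenvalues l : ℝ) : ℂ) * K k l := by
      rw [Matrix.sub_apply, hD, diagonal_mul, mul_diagonal]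
      push_cast
      ring
    rw [this, norm_mul, mul_pow, Complex.norm_real, Real.norm_eq_abs, sq_abs]
  rw [hentry]
  split_ifs with h
  · refine mul_le_mul_of_nonneg_right ?_ (sq_nonneg _)
    -- The diagonal is separate because `2λ_k` may exceed 1; there the numerator vanishes.
    by_cases hkl : k = l
    · simp [hkl]
    · rw [le_div_iff₀ h]
      refine mul_le_of_le_one_right (sq_nonneg _) ?_
      rw [← hsum, ← Finset.sum_pair hkl]
      exact Finset.sum_le_sum_of_subset_of_nonneg (Finset.subset_univ _) fun i _ _ => hnn i
  · have h1 := hnn k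
    have h2 := hnn l
    have h3 : hρ.eigenvalues k - hρ.eigenvalues l = 0 := by linarith
    simp [h3]

end Frobenius

/-- Since `H` has diagonal entries `N - 2w`, the commutator scales each coherence by twice a weight
difference; squaring this and the factor 2 of the commutator bound give the 8. -/
theorem le_qfi_dephased {N : ℕ} {p : ℝ} (hp0 : 0 ≤ p) (hp1 : p ≤ 1) {φ : Bits N → ℂ}
    (hφ : ∑ y, ‖φ y‖ ^ 2 = 1) :
    8 * (1 - 2 * p) ^ (2 * N) *
        ∑ y, ∑ z, ‖φ y‖ ^ 2 * (‖φ z‖ ^ 2 * ((weight y : ℝ) - weight z) ^ 2) ≤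
      qfi (dephased p φ) (generator N) (dephased_isHermitian p φ) := by
  refine le_trans ?_ (two_mul_sum_norm_sq_commutator_le_qfi _ (dephased_posSemidef hp0 hp1 φ)
    (by rw [trace_dephased, hφ, Complex.ofReal_one]))
  simp_rw [Finset.mul_sum]
  refine Finset.sum_le_sum fun y _ => Finset.sum_le_sum fun z _ => ?_
  have h : (dephased p φ * generator N - generator N * dephased p φ) y z =
      ((2 * ((weight y : ℝ) - weight z) : ℝ) : ℂ) * dephased p φ y z := by
    rw [generator_eq_diagonal, Matrix.sub_apply, diagonal_mul, mul_diagonal]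
    push_cast
    ring
  rw [h, dephased_apply, norm_mul, norm_mul, norm_mul, norm_star, Complex.norm_real,
    Complex.norm_real]
  simp only [mul_pow, Real.norm_eq_abs, sq_abs]
  have := mul_le_mul_of_nonneg_left (dephasing_factor_sq_ge hp0 hp1 y z)
    (show 0 ≤ 8 * (‖φ y‖ ^ 2 * (‖φ z‖ ^ 2 * ((weight y : ℝ) - weight z) ^ 2)) by positivity)
  linarith

/-! ### An upper bound for `gTwo` -/

theorem abs_zMoment_le_one {N : ℕ} {φ : Bits N → ℂ} (hφ : ∑ y, ‖φ y‖ ^ 2 = 1) (j : ℕ) :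
    |zMoment φ j| ≤ 1 := by
  unfold zMoment
  rw [tensorOp_ite_pauliZ]
  refine (Complex.abs_re_le_norm _).trans ?_
  refine (norm_sum_le _ _).trans ((Finset.sum_le_sum fun y _ => ?_).trans_eq hφ)
  have h1 : ‖∏ i : Fin N, (if (i : ℕ) < j then bitSign (y i) else 1)‖ = 1 := by
    rw [Real.norm_eq_abs, Finset.abs_prod]
    refine Finset.prod_eq_one fun i _ => ?_
    split_ifs
    · exact abs_bitSign _
    · exact abs_one
  rw [mulVec_diagonal, norm_mul, norm_mul, Complex.norm_real, h1, Pi.star_apply, norm_star]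
  exact le_of_eq (by ring)

/-- In `z112` the terms other than `N³/4` form `N(N-1)((N-2)v₃+1)²`, so `z112 ≥ 0`. In `z022`,
replacing the moments by the bound 1 makes the polynomial collapse to `N⁴`. -/
theorem gTwo_le {N : ℕ} (hN : 2 ≤ N) {φ : Bits N → ℂ} (hφ : ∑ y, ‖φ y‖ ^ 2 = 1) :
    gTwo φ ≤ 2 * (N : ℝ) ^ 4 := by
  have h2 := abs_zMoment_le_one hφ 2
  have h4 := abs_zMoment_le_one hφ 4
  unfold gTwo z022 z112
  generalize zMoment φ 2 = a at *
  generalize zMoment φ 3 = b at *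
  generalize zMoment φ 4 = c at *
  have hN2 : (2 : ℝ) ≤ N := by exact_mod_cast hN
  -- This uses that `N` is an integer: the product is negative strictly between 2 and 3.
  have h23 : 0 ≤ ((N : ℝ) - 2) * (N - 3) := by
    rcases Nat.lt_or_ge N 3 with h | h
    · have : N = 2 := by omega
      subst this
      norm_num
    · have : (3 : ℝ) ≤ N := by exact_mod_cast h
      exact mul_nonneg (by linarith) (by linarith)
  set M : ℝ := (N : ℝ)
  have hX : |(M - 2) * (M - 3) * c + (5 * M - 8) * a + 2| ≤ M ^ 2 := by
    have ha := abs_le.mp h2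
    have hc := abs_le.mp h4
    have h58 : 0 ≤ 5 * M - 8 := by linarith
    rw [abs_le]
    constructor
    · nlinarith [mul_le_mul_of_nonneg_left ha.1 h58, mul_le_mul_of_nonneg_left hc.1 h23]
    · nlinarith [mul_le_mul_of_nonneg_left ha.2 h58, mul_le_mul_of_nonneg_left hc.2 h23]
  have haX : a * ((M - 2) * (M - 3) * c + (5 * M - 8) * a + 2) ≤ M ^ 2 := by
    refine (le_abs_self _).trans ?_
    rw [abs_mul]
    calc _ ≤ 1 * M ^ 2 := mul_le_mul h2 hX (abs_nonneg _) zero_le_one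
      _ = _ := one_mul _
  have hNN : 0 ≤ M * (M - 1) := mul_nonneg (by linarith) (by linarith)
  have e1 := mul_le_mul_of_nonneg_left haX hNN
  have e2 := mul_le_mul_of_nonneg_left (abs_le.mp h2).2
    (show 0 ≤ M ^ 2 * (M - 1) from mul_nonneg (sq_nonneg _) (by linarith))
  have e3 := mul_nonneg hNN (sq_nonneg ((M - 2) * b + 1))
  have e4 : 0 ≤ M ^ 3 := by positivity
  linear_combination 2 * e1 + 2 * e2 + 2 * e3 + e4 / 2

/-! ### Weight distribution of the gnu probe -/

theorem weight_eq_card {N : ℕ} (x : Bits N) :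
    weight x = (Finset.univ.filter fun i => x i = 1).card := by
  rw [Finset.card_filter]
  refine Finset.sum_congr rfl fun i _ => ?_
  generalize x i = b
  fin_cases b <;> simp

theorem card_weight_eq (N w : ℕ) :
    (Finset.univ.filter fun x : Bits N => weight x = w).card = N.choose w := by
  have h : (Finset.powersetCard w (Finset.univ : Finset (Fin N))).card = N.choose w := by simp
  rw [← h]
  refine Finset.card_nbij' (fun x => Finset.univ.filter fun i => x i = 1)
    (fun s i => if i ∈ s then 1 else 0) ?_ ?_ ?_ ?_
  · intro x hx
    simpa [Finset.mem_powersetCard, weight_eq_card] using hx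
  · intro s hs
    simpa [Finset.mem_powersetCard, weight_eq_card] using hs
  · intro x _
    funext i
    simp only [Finset.mem_filter, Finset.mem_univ, true_and]
    generalize x i = b
    fin_cases b <;> simp
  · intro s _
    ext i
    simp

/-- As `g > 0`, the weights `gj` are distinct: each bit string meets at most one Dicke component and
no cross terms arise. -/
theorem norm_gnuProbe_sq {g : ℕ} (hg : 0 < g) (N n : ℕ) (x : Bits N) :
    ‖gnuProbe N g n x‖ ^ 2 = ∑ j ∈ Finset.range (n + 1),
      if weight x = g * j then (n.choose j : ℝ) / 2 ^ n / N.choose (g * j) else 0 := by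
  unfold gnuProbe dicke
  by_cases h : ∃ j ∈ Finset.range (n + 1), weight x = g * j
  · obtain ⟨j, hj, hx⟩ := h
    have hne : ∀ i, i ≠ j → ¬ weight x = g * i := fun i hi h' =>
      hi (Nat.eq_of_mul_eq_mul_left hg (h'.symm.trans hx))
    rw [Finset.sum_eq_single_of_mem j hj fun i _ hi => by rw [if_neg (hne i hi), mul_zero],
      Finset.sum_eq_single_of_mem j hj fun i _ hi => by rw [if_neg (hne i hi)],
      if_pos hx, if_pos hx, ← Complex.ofReal_mul, ← Complex.ofReal_mul, Complex.norm_real,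
      Real.norm_eq_abs, sq_abs, mul_pow, mul_pow, div_pow, Real.sq_sqrt (by positivity),
      Real.sq_sqrt (by positivity), Real.sq_sqrt (by positivity)]
    ring
  · push Not at h
    rw [Finset.sum_eq_zero fun i hi => by rw [if_neg (h i hi), mul_zero],
      Finset.sum_eq_zero fun i hi => by rw [if_neg (h i hi)]]
    simp

/-- The Hamming weight in the gnu probe state is `g` times a symmetric binomial variable. -/
theorem sum_norm_gnuProbe_sq_mul {N g n : ℕ} (hg : 0 < g) (hN : g * n ≤ N) (f : ℕ → ℝ) :
    ∑ x, ‖gnuProbe N g n x‖ ^ 2 * f (weight x) =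
      ∑ j ∈ Finset.range (n + 1), (n.choose j : ℝ) / 2 ^ n * f (g * j) := by
  simp_rw [norm_gnuProbe_sq hg, Finset.sum_mul]
  rw [Finset.sum_comm]
  refine Finset.sum_congr rfl fun j hj => ?_
  have hle : g * j ≤ N :=
    (Nat.mul_le_mul_left g (Nat.lt_succ_iff.mp (Finset.mem_range.mp hj))).trans hN
  have hpos : (N.choose (g * j) : ℝ) ≠ 0 := by exact_mod_cast (Nat.choose_pos hle).ne'
  calc ∑ x : Bits N, (if weight x = g * j then (n.choose j : ℝ) / 2 ^ n / N.choose (g * j) else 0) *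
        f (weight x)
      = ∑ x : Bits N, if weight x = g * j then
          (n.choose j : ℝ) / 2 ^ n / N.choose (g * j) * f (g * j) else 0 := by
        refine Finset.sum_congr rfl fun x _ => ?_
        split_ifs with h
        · rw [h]
        · exact zero_mul _
    _ = _ := by
        rw [← Finset.sum_filter, Finset.sum_const, card_weight_eq, nsmul_eq_mul]
        field_simp

/-! ### Binomial moments, from Bernstein polynomials at 1/2 -/

theorem bernsteinPolynomial_eval_half (n j : ℕ) (hj : j ∈ Finset.range (n + 1)) :
    (bernsteinPolynomial ℝ n j).eval (1 / 2) = (n.choose j : ℝ) / 2 ^ n := by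
  have h : j + (n - j) = n := by
    have := Finset.mem_range.mp hj
    omega
  have h2 : (1 - 1 / 2 : ℝ) = 1 / 2 := by norm_num
  simp only [bernsteinPolynomial, Polynomial.eval_mul, Polynomial.eval_pow, Polynomial.eval_sub,
    Polynomial.eval_one, Polynomial.eval_X, Polynomial.eval_natCast]
  rw [h2, mul_assoc, ← pow_add, h, one_div, inv_pow, div_eq_mul_inv]

theorem sum_binomial (n : ℕ) :
    ∑ j ∈ Finset.range (n + 1), (n.choose j : ℝ) / 2 ^ n = 1 := by
  have h := congrArg (Polynomial.eval (1 / 2 : ℝ)) (bernsteinPolynomial.sum ℝ n)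
  rw [Polynomial.eval_finsetSum, Polynomial.eval_one] at h
  rw [← h]
  exact Finset.sum_congr rfl fun j hj => (bernsteinPolynomial_eval_half n j hj).symm

theorem sum_binomial_mul (n : ℕ) :
    ∑ j ∈ Finset.range (n + 1), (n.choose j : ℝ) / 2 ^ n * j = (n : ℝ) / 2 := by
  have h := congrArg (Polynomial.eval (1 / 2 : ℝ)) (bernsteinPolynomial.sum_smul ℝ n)
  rw [Polynomial.eval_finsetSum] at h
  simp only [nsmul_eq_mul, Polynomial.eval_mul, Polynomial.eval_natCast, Polynomial.eval_X] at h
  rw [div_eq_mul_one_div, ← h]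
  refine Finset.sum_congr rfl fun j hj => ?_
  rw [bernsteinPolynomial_eval_half n j hj, mul_comm]

theorem sum_binomial_mul_sq (n : ℕ) :
    ∑ j ∈ Finset.range (n + 1), (n.choose j : ℝ) / 2 ^ n * ((j : ℝ) - n / 2) ^ 2 = (n : ℝ) / 4 := by
  have h := congrArg (Polynomial.eval (1 / 2 : ℝ)) (bernsteinPolynomial.variance ℝ n)
  rw [Polynomial.eval_finsetSum] at h
  simp only [nsmul_eq_mul, Polynomial.eval_mul, Polynomial.eval_natCast, Polynomial.eval_X,
    Polynomial.eval_sub, Polynomial.eval_one, Polynomial.eval_pow] at h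
  have e : (n : ℝ) / 4 = n * (1 / 2) * (1 - 1 / 2) := by ring
  rw [e, ← h]
  refine Finset.sum_congr rfl fun j hj => ?_
  rw [bernsteinPolynomial_eval_half n j hj]
  ring

theorem sum_norm_gnuProbe_sq {N g n : ℕ} (hg : 0 < g) (hN : g * n ≤ N) :
    ∑ x, ‖gnuProbe N g n x‖ ^ 2 = 1 := by
  have h := sum_norm_gnuProbe_sq_mul hg hN fun _ => 1
  simpa [sum_binomial] using h

/-- For two independent copies of the weight, the mean squared difference is twice the variance
`g²n/4`. -/
theorem sum_sum_norm_gnuProbe_sq_mul {N g n : ℕ} (hg : 0 < g) (hN : g * n ≤ N) :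
    ∑ y, ∑ z, ‖gnuProbe N g n y‖ ^ 2 *
      (‖gnuProbe N g n z‖ ^ 2 * ((weight y : ℝ) - weight z) ^ 2) = (g : ℝ) ^ 2 * n / 2 := by
  have hz : ∀ w : ℕ, ∑ z, ‖gnuProbe N g n z‖ ^ 2 * ((w : ℝ) - weight z) ^ 2 =
      ((w : ℝ) - g * n / 2) ^ 2 + (g : ℝ) ^ 2 * n / 4 := fun w => by
    rw [sum_norm_gnuProbe_sq_mul hg hN fun v => ((w : ℝ) - v) ^ 2]
    calc ∑ j ∈ Finset.range (n + 1), (n.choose j : ℝ) / 2 ^ n * ((w : ℝ) - (g * j : ℕ)) ^ 2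
        = ∑ j ∈ Finset.range (n + 1),
          ((((w : ℝ) - g * n / 2) ^ 2 + ((w : ℝ) - g * n / 2) * g * n) *
              ((n.choose j : ℝ) / 2 ^ n)
            - 2 * ((w : ℝ) - g * n / 2) * g * ((n.choose j : ℝ) / 2 ^ n * j)
            + (g : ℝ) ^ 2 * ((n.choose j : ℝ) / 2 ^ n * ((j : ℝ) - n / 2) ^ 2)) := by
          refine Finset.sum_congr rfl fun j _ => ?_
          push_cast
          ring
      _ = _ := by
          rw [Finset.sum_add_distrib, Finset.sum_sub_distrib, ← Finset.mul_sum, ← Finset.mul_sum,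
            ← Finset.mul_sum, sum_binomial, sum_binomial_mul, sum_binomial_mul_sq]
          ring
  simp_rw [← Finset.mul_sum, hz]
  rw [sum_norm_gnuProbe_sq_mul hg hN fun w => ((w : ℝ) - g * n / 2) ^ 2 + (g : ℝ) ^ 2 * n / 4]
  calc ∑ j ∈ Finset.range (n + 1), (n.choose j : ℝ) / 2 ^ n *
        ((((g * j : ℕ) : ℝ) - g * n / 2) ^ 2 + (g : ℝ) ^ 2 * n / 4)
      = ∑ j ∈ Finset.range (n + 1),
        ((g : ℝ) ^ 2 * ((n.choose j : ℝ) / 2 ^ n * ((j : ℝ) - n / 2) ^ 2)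
          + (g : ℝ) ^ 2 * n / 4 * ((n.choose j : ℝ) / 2 ^ n)) := by
        refine Finset.sum_congr rfl fun j _ => ?_
        push_cast
        ring
    _ = _ := by
        rw [Finset.sum_add_distrib, ← Finset.mul_sum, ← Finset.mul_sum, sum_binomial,
          sum_binomial_mul_sq]
        ring

theorem le_qfi_dephased_gnuProbe {N g n : ℕ} (hg : 0 < g) (hN : g * n ≤ N) {p : ℝ}
    (hp0 : 0 ≤ p) (hp1 : p ≤ 1) :
    4 * ((g : ℝ) ^ 2 * n) * (1 - 2 * p) ^ (2 * N) ≤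
      qfi (dephased p (gnuProbe N g n)) (generator N)
        (dephased_isHermitian p (gnuProbe N g n)) := by
  have h := le_qfi_dephased hp0 hp1 (sum_norm_gnuProbe_sq hg hN)
  rw [sum_sum_norm_gnuProbe_sq_mul hg hN] at h
  linarith

end Metrology

/-! ### Comparison with the claimed bound -/

theorem mainTheorem6 (g n N : ℕ) (hg : 0 < g) (hn : 0 < n) (hN : N = 2 * g * n)
    (p t : ℝ) (hp0 : 0 ≤ p) (hp1 : p ≤ 1) (ht : t = p * N) :
    (1 - p) ^ (2 * N - 2) *
          (2 * (1 - p) ^ 2 * (g : ℝ) ^ 2 * n + p * (1 - p) * (g : ℝ) ^ 2 * ((n : ℝ) - 1)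
            + p ^ 2 * (Metrology.gTwo (Metrology.gnuProbe N g n) / (N : ℝ) ^ 2))
        - 2 * (N : ℝ) ^ 2 * t * Real.exp 1
      ≤ Metrology.qfi (Metrology.dephased p (Metrology.gnuProbe N g n)) (Metrology.generator N)
          (Metrology.dephased_isHermitian p (Metrology.gnuProbe N g n)) := by
  have hgn : 0 < g * n := Nat.mul_pos hg hn
  have hgnN : g * n ≤ N := by rw [hN, mul_assoc]; omega
  have hN2 : 2 ≤ N := by rw [hN, mul_assoc]; omega
  refine le_trans ?_ (Metrology.le_qfi_dephased_gnuProbe hg hgnN hp0 hp1)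
  have hG := Metrology.gTwo_le hN2 (Metrology.sum_norm_gnuProbe_sq hg hgnN)
  generalize Metrology.gTwo (Metrology.gnuProbe N g n) = G at hG ⊢
  have hn1 : (1 : ℝ) ≤ n := by exact_mod_cast hn
  have hM2 : (2 : ℝ) ≤ N := by exact_mod_cast hN2
  -- In fact `g²n = N²/(4n)`.
  have hA4 : (g : ℝ) ^ 2 * n ≤ (N : ℝ) ^ 2 / 4 := by
    have h1 : (N : ℝ) = 2 * g * n := by exact_mod_cast hN
    rw [h1]
    nlinarith [mul_nonneg (mul_nonneg (sq_nonneg (g : ℝ)) (by linarith : (0 : ℝ) ≤ n))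
      (sub_nonneg.mpr hn1)]
  have hA0 : 0 ≤ (g : ℝ) ^ 2 * n := by positivity
  have hq : 0 ≤ 1 - p := by linarith
  -- This averages Bernoulli's bound `1 - 4Np` with the bound 0. The leading term `4A` drops to the
  -- `2A` that suffices, and the loss linear in `p` is halved, which keeps it within the budget
  -- `4N³p` for all `p ≤ 1`.
  have hbern : (1 - 4 * N * p) / 2 ≤ (1 - 2 * p) ^ (2 * N) := by
    have h1 := one_add_mul_le_pow (show (-2 : ℝ) ≤ -(2 * p) by linarith) (2 * N)
    have h2 : 0 ≤ (1 - 2 * p) ^ (2 * N) := (even_two_mul N).pow_nonneg _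
    rw [← sub_eq_add_neg] at h1
    push_cast at h1
    linarith
  have hlow := mul_le_mul_of_nonneg_left hbern (show 0 ≤ 4 * ((g : ℝ) ^ 2 * n) by positivity)
  have hGN : G / (N : ℝ) ^ 2 ≤ 2 * (N : ℝ) ^ 2 := by
    rw [div_le_iff₀ (by positivity)]
    linarith
  have hexp : 2 ≤ Real.exp 1 := by linarith [Real.add_one_le_exp (1 : ℝ)]
  have hpexp : 4 * (N : ℝ) ^ 3 * p ≤ 2 * (N : ℝ) ^ 2 * t * Real.exp 1 := by
    have := mul_le_mul_of_nonneg_left hexp (show 0 ≤ 2 * (N : ℝ) ^ 2 * t by rw [ht]; positivity)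
    calc 4 * (N : ℝ) ^ 3 * p = 2 * (N : ℝ) ^ 2 * t * 2 := by rw [ht]; ring
      _ ≤ _ := this
  have hpp : p ^ 2 ≤ p := by nlinarith
  have hb1 : 2 * (1 - p) ^ 2 * (g : ℝ) ^ 2 * n ≤ 2 * ((g : ℝ) ^ 2 * n) := by
    have : (1 - p) ^ 2 ≤ 1 := pow_le_one₀ hq (by linarith)
    nlinarith [mul_le_mul_of_nonneg_right this hA0]
  have hb2 : p * (1 - p) * (g : ℝ) ^ 2 * ((n : ℝ) - 1) ≤ p * ((g : ℝ) ^ 2 * n) := by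
    have h1 : (g : ℝ) ^ 2 * ((n : ℝ) - 1) ≤ (g : ℝ) ^ 2 * n :=
      mul_le_mul_of_nonneg_left (by linarith) (sq_nonneg _)
    calc p * (1 - p) * (g : ℝ) ^ 2 * ((n : ℝ) - 1)
        = p * (1 - p) * ((g : ℝ) ^ 2 * ((n : ℝ) - 1)) := by ring
      _ ≤ p * ((g : ℝ) ^ 2 * n) :=
        mul_le_mul (mul_le_of_le_one_right hp0 (by linarith)) h1
          (mul_nonneg (sq_nonneg _) (by linarith)) hp0
  have hb3 : p ^ 2 * (G / (N : ℝ) ^ 2) ≤ p * (2 * (N : ℝ) ^ 2) :=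
    (mul_le_mul_of_nonneg_left hGN (sq_nonneg p)).trans
      (mul_le_mul_of_nonneg_right hpp (by positivity))
  -- `G` has no lower bound here, so the bracket is first replaced by a nonnegative bound; only then
  -- can the prefactor, at most 1, be dropped.
  have hbracket : (1 - p) ^ (2 * N - 2) *
          (2 * (1 - p) ^ 2 * (g : ℝ) ^ 2 * n + p * (1 - p) * (g : ℝ) ^ 2 * ((n : ℝ) - 1)
            + p ^ 2 * (G / (N : ℝ) ^ 2)) ≤
      2 * ((g : ℝ) ^ 2 * n) + p * ((g : ℝ) ^ 2 * n) + p * (2 * (N : ℝ) ^ 2) :=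
    (mul_le_mul_of_nonneg_left (add_le_add (add_le_add hb1 hb2) hb3) (pow_nonneg hq _)).trans
      (mul_le_of_le_one_left (by positivity) (pow_le_one₀ hq (by linarith)))
  generalize (g : ℝ) ^ 2 * (n : ℝ) = A at *
  have k1 := mul_le_mul_of_nonneg_left hA4 hp0
  have k2 := mul_le_mul_of_nonneg_left hA4 (show 0 ≤ 8 * (N : ℝ) * p by positivity)
  have k3 : 0 ≤ p * (N : ℝ) ^ 2 * ((N : ℝ) - 2) :=
    mul_nonneg (by positivity) (by linarith)
  have k4 : 0 ≤ p * (N : ℝ) ^ 2 * (N : ℝ) := by positivity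
  -- What remains is `p(A + 2N² + 8AN) ≤ 4N³p`; with `A ≤ N²/4` it reduces to `(9/4)N² ≤ 2N³`, true
  -- for `N ≥ 2`.
  nlinarith
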